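/- Let $\mathcal H$ be a complex Hilbert space and let $A_1,\dots,A_N$ be finitely many bounded self-adjoint operators on $\mathcal H$ such that $A_iA_j$ is compact for all $i\neq j$. Put $A=\sum_{i=1}^N A_i$. For a bounded self-adjoint operator $B$ on $\mathcal H$ let $E_B$ denote its projection-valued spectral measure on the Borel subsets of $\mathbb R$, so that $B=\int_{\mathbb R} t\,dE_B(t)$, and let the essential spectrum $\sigma_e(B)$ be the set of all $\lambda$ in the spectrum $\sigma(B)$ such that $\lambda$ is a limit point of $\sigma(B)$ or $\ker(B-\lambda I)$ is infinite dimensional. For $\varepsilon>0$ put $$\mathcal H_\varepsilon=\bigcap_{i=1}^N E_{A_i}([-\varepsilon,\varepsilon])\mathcal H .$$ Then $0\in\sigma_e(A)$ if and only if the subspace $\mathcal H_\varepsilon$ is infinite dimensional for every $\varepsilon>0$. -/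

import Mathlib

open MeasureTheory Filter Topology Set
open scoped CompactlySupported InnerProductSpace NNReal

noncomputable section

namespace SpectralSum

/-- The essential spectrum of a bounded (self-adjoint) operator: the points of the spectrum that
are limit points of the spectrum or eigenvalues of infinite multiplicity. -/
def essentialSpectrum {H : Type*} [NormedAddCommGroup H] [InnerProductSpace ℂ H]
    (A : H →L[ℂ] H) : Set ℂ :=
  {z | z ∈ spectrum ℂ A ∧
    (AccPt z (𝓟 (spectrum ℂ A)) ∨
      ¬ FiniteDimensional ℂ (LinearMap.ker (A - z • (1 : H →L[ℂ] H)).toLinearMap))}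

/-- A projection-valued (spectral) measure on the Borel subsets of `ℝ`. -/
structure ProjectionValuedMeasure (H : Type*) [NormedAddCommGroup H] [InnerProductSpace ℂ H]
    [CompleteSpace H] where
  /-- the orthogonal projection `E(S)` (meaningful for Borel sets `S`) -/
  proj : Set ℝ → H →L[ℂ] H
  isStarProjection : ∀ S, MeasurableSet S → IsStarProjection (proj S)
  univ : proj Set.univ = 1
  hasSum_iUnion : ∀ S : ℕ → Set ℝ, (∀ n, MeasurableSet (S n)) →
    Pairwise (Function.onFun Disjoint S) → ∀ x, HasSum (fun n => proj (S n) x) (proj (⋃ n, S n) x)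

section Construction

variable {H : Type*} [NormedAddCommGroup H] [InnerProductSpace ℂ H] [CompleteSpace H]

/-- The positive functional `f ↦ ⟪f(A) x, x⟫` on the continuous functions on the spectrum. -/
def spectralFunctional (A : H →L[ℂ] H) (hA : IsSelfAdjoint A) (x : H) :
    C_c(spectrum ℝ A, ℝ) →ₚ[ℝ] ℝ :=
  PositiveLinearMap.mk₀
    { toFun := fun f => (⟪cfcHom hA f.toContinuousMap x, x⟫_ℂ).re
      map_add' := fun f g => by
        have : (f + g).toContinuousMap = f.toContinuousMap + g.toContinuousMap := rfl
        rw [this, map_add]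
        simp
      map_smul' := fun c f => by
        have : (c • f).toContinuousMap = c • f.toContinuousMap := rfl
        rw [this, map_smul]
        simp [inner_smul_left_eq_smul] }
    (fun f hf => by
      have h0 : 0 ≤ cfcHom hA f.toContinuousMap := by
        rw [cfcHom_nonneg_iff]
        intro t
        exact hf t
      have := ((ContinuousLinearMap.nonneg_iff_isPositive _).1 h0).re_inner_nonneg_left x
      simpa using this)

/-- The scalar spectral measure of `A` at `x`: the measure on the spectrum that represents
`f ↦ ⟪f(A) x, x⟫`. -/
def scalarSpectralMeasure (A : H →L[ℂ] H) (hA : IsSelfAdjoint A) (x : H) :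
    Measure (spectrum ℝ A) :=
  RealRMK.rieszMeasure (spectralFunctional A hA x)

instance (A : H →L[ℂ] H) (hA : IsSelfAdjoint A) (x : H) :
    (scalarSpectralMeasure A hA x).Regular := by
  unfold scalarSpectralMeasure; infer_instance

instance (A : H →L[ℂ] H) (hA : IsSelfAdjoint A) (x : H) :
    IsFiniteMeasure (scalarSpectralMeasure A hA x) :=
  ⟨isCompact_univ.measure_lt_top⟩

theorem integral_scalarSpectralMeasure (A : H →L[ℂ] H) (hA : IsSelfAdjoint A) (x : H)
    (f : C(spectrum ℝ A, ℝ)) :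
    ∫ t, f t ∂(scalarSpectralMeasure A hA x) = (⟪cfcHom hA f x, x⟫_ℂ).re :=
  RealRMK.integral_rieszMeasure (spectralFunctional A hA x)
    (CompactlySupportedContinuousMap.continuousMapEquiv f)

theorem integral_scalarSpectralMeasure' (A : H →L[ℂ] H) (hA : IsSelfAdjoint A) (x : H)
    (f : C(spectrum ℝ A, ℝ)) :
    ((∫ t, f t ∂(scalarSpectralMeasure A hA x) : ℝ) : ℂ) = ⟪cfcHom hA f x, x⟫_ℂ := by
  have h1 : IsSelfAdjoint (cfcHom hA f) := cfcHom_predicate hA f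
  have h2 := h1.isSymmetric.coe_re_inner_apply_self x
  rw [integral_scalarSpectralMeasure]
  simpa using h2

theorem integral_sq_scalarSpectralMeasure (A : H →L[ℂ] H) (hA : IsSelfAdjoint A) (x : H)
    (f : C(spectrum ℝ A, ℝ)) :
    ∫ t, (f t) ^ 2 ∂(scalarSpectralMeasure A hA x) = ‖cfcHom hA f x‖ ^ 2 := by
  have h1 : IsSelfAdjoint (cfcHom hA f) := cfcHom_predicate hA f
  have h := integral_scalarSpectralMeasure A hA x (f * f)
  have h3 : ⟪cfcHom hA f (cfcHom hA f x), x⟫_ℂ = ⟪cfcHom hA f x, cfcHom hA f x⟫_ℂ :=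
    h1.isSymmetric _ _
  rw [map_mul, mul_apply_eq_comp, h3] at h
  simp only [pow_two, ContinuousMap.mul_apply] at h ⊢
  rw [h, ← pow_two, ← inner_self_eq_norm_sq (𝕜 := ℂ)]
  rfl

theorem scalarSpectralMeasure_univ (A : H →L[ℂ] H) (hA : IsSelfAdjoint A) (x : H) :
    (scalarSpectralMeasure A hA x).real univ = ‖x‖ ^ 2 := by
  have h := integral_sq_scalarSpectralMeasure A hA x 1
  simpa using h

/-- `T` is the operator that represents the indicator function of `S`. -/
def Represents (A : H →L[ℂ] H) (hA : IsSelfAdjoint A) (S : Set (spectrum ℝ A))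
    (T : H →L[ℂ] H) : Prop :=
  IsStarProjection T ∧ ∀ x, ⟪T x, x⟫_ℂ = ((scalarSpectralMeasure A hA x).real S : ℂ)

theorem isStarProjection_of_norm_sq (T : H →L[ℂ] H)
    (h : ∀ x, ⟪T x, x⟫_ℂ = ((‖T x‖ ^ 2 : ℝ) : ℂ)) : IsStarProjection T := by
  have key : star T * T = T := by
    apply ContinuousLinearMap.coe_injective
    rw [← ext_inner_map]
    intro x
    have : ⟪(star T * T) x, x⟫_ℂ = ⟪T x, T x⟫_ℂ := ContinuousLinearMap.adjoint_inner_left T x (T x)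
    change ⟪(star T * T) x, x⟫_ℂ = ⟪T x, x⟫_ℂ
    rw [this, h x, inner_self_eq_norm_sq_to_K]
    simp
  have hs : IsSelfAdjoint T := by
    rw [← key]; exact IsSelfAdjoint.star_mul_self T
  refine ⟨?_, hs⟩
  rw [hs.star_eq] at key
  exact key

theorem inner_eq_norm_sq_of_isStarProjection {T : H →L[ℂ] H} (hT : IsStarProjection T) (x : H) :
    ⟪T x, x⟫_ℂ = ((‖T x‖ ^ 2 : ℝ) : ℂ) := by
  have h1 : T (T x) = T x := DFunLike.congr_fun hT.isIdempotentElem x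
  have h2 : ⟪T (T x), x⟫_ℂ = ⟪T x, T x⟫_ℂ := hT.isSelfAdjoint.isSymmetric _ _
  rw [h1] at h2
  rw [h2, inner_self_eq_norm_sq_to_K]
  simp

theorem Represents.norm_sq {A : H →L[ℂ] H} {hA : IsSelfAdjoint A} {S : Set (spectrum ℝ A)}
    {T : H →L[ℂ] H} (h : Represents A hA S T) (x : H) :
    ‖T x‖ ^ 2 = (scalarSpectralMeasure A hA x).real S := by
  have h1 := inner_eq_norm_sq_of_isStarProjection h.1 x
  rw [h.2 x] at h1
  exact_mod_cast h1.symm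

theorem Represents.unique {A : H →L[ℂ] H} {hA : IsSelfAdjoint A} {S : Set (spectrum ℝ A)}
    {T T' : H →L[ℂ] H} (h : Represents A hA S T) (h' : Represents A hA S T') : T = T' := by
  apply ContinuousLinearMap.coe_injective
  rw [← ext_inner_map]
  intro x
  exact (h.2 x).trans (h'.2 x).symm

theorem represents_of_tendsto (A : H →L[ℂ] H) (hA : IsSelfAdjoint A) (S : Set (spectrum ℝ A))
    (T : ℕ → H →L[ℂ] H) (hC : ∀ x, CauchySeq fun n => T n x)
    (h1 : ∀ x, Tendsto (fun n => ⟪T n x, x⟫_ℂ) atTop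
      (𝓝 ((scalarSpectralMeasure A hA x).real S : ℂ)))
    (h2 : ∀ x, Tendsto (fun n => ‖T n x‖ ^ 2) atTop
      (𝓝 ((scalarSpectralMeasure A hA x).real S))) :
    ∃ T' : H →L[ℂ] H, Represents A hA S T' ∧ ∀ x, Tendsto (fun n => T n x) atTop (𝓝 (T' x)) := by
  choose g hg using fun x => cauchySeq_tendsto_of_complete (hC x)
  let T' : H →L[ℂ] H := continuousLinearMapOfTendsto T (f := g) (tendsto_pi_nhds.2 hg)
  have hT' : ∀ x, Tendsto (fun n => T n x) atTop (𝓝 (T' x)) := hg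
  have e1 : ∀ x, ⟪T' x, x⟫_ℂ = ((scalarSpectralMeasure A hA x).real S : ℂ) := fun x =>
    tendsto_nhds_unique ((hT' x).inner tendsto_const_nhds) (h1 x)
  have e2 : ∀ x, ‖T' x‖ ^ 2 = (scalarSpectralMeasure A hA x).real S := fun x =>
    tendsto_nhds_unique ((hT' x).norm.pow 2) (h2 x)
  refine ⟨T', ⟨isStarProjection_of_norm_sq T' fun x => ?_, e1⟩, hT'⟩
  rw [e1, e2]

theorem exists_represents_isClosed (A : H →L[ℂ] H) (hA : IsSelfAdjoint A)
    (F : Set (spectrum ℝ A)) (hF : IsClosed F) : ∃ T, Represents A hA F T := by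
  let f : ℕ → C(spectrum ℝ A, ℝ) := fun n =>
    ⟨fun t => (hF.apprSeq n t : ℝ), NNReal.continuous_coe.comp (hF.apprSeq n).continuous⟩
  have f0 : ∀ n t, 0 ≤ f n t := fun n t => NNReal.coe_nonneg _
  have f1 : ∀ n t, f n t ≤ 1 := fun n t => by
    exact_mod_cast HasOuterApproxClosed.apprSeq_apply_le_one hF n t
  have ft : ∀ t, Tendsto (fun n => f n t) atTop (𝓝 (F.indicator (fun _ => (1 : ℝ)) t)) := by
    intro t
    have h := tendsto_pi_nhds.1 (HasOuterApproxClosed.tendsto_apprSeq hF) t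
    have h' := (NNReal.continuous_coe.tendsto _).comp h
    have e : ((F.indicator (fun _ => (1 : ℝ≥0)) t : ℝ≥0) : ℝ)
        = F.indicator (fun _ => (1 : ℝ)) t := by
      by_cases ht : t ∈ F <;> simp [ht]
    rw [← e]
    exact h'
  have fsq : ∀ n t, (f n t) ^ 2 ≤ 1 := fun n t => pow_le_one₀ (f0 n t) (f1 n t)
  have hind : ∀ x, ∫ t, F.indicator (fun _ => (1 : ℝ)) t ∂(scalarSpectralMeasure A hA x)
      = (scalarSpectralMeasure A hA x).real F := fun x => by
    rw [integral_indicator_const _ hF.measurableSet]; simp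
  refine (represents_of_tendsto A hA F (fun n => cfcHom hA (f n)) ?_ ?_ ?_).imp fun T hT => hT.1
  · intro x
    rw [cauchySeq_iff_tendsto_dist_atTop_0]
    have e : ∀ p : ℕ × ℕ, dist (cfcHom hA (f p.1) x) (cfcHom hA (f p.2) x)
        = √(∫ t, (f p.1 t - f p.2 t) ^ 2 ∂(scalarSpectralMeasure A hA x)) := by
      intro p
      have h := integral_sq_scalarSpectralMeasure A hA x (f p.1 - f p.2)
      simp only [ContinuousMap.sub_apply] at h
      rw [h, Real.sqrt_sq (norm_nonneg _), dist_eq_norm, map_sub, _root_.sub_apply]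
    simp only [e]
    have h0 : Tendsto (fun p : ℕ × ℕ => ∫ t, (f p.1 t - f p.2 t) ^ 2
        ∂(scalarSpectralMeasure A hA x)) atTop
        (𝓝 (∫ _t, (0 : ℝ) ∂(scalarSpectralMeasure A hA x))) := by
      apply tendsto_integral_filter_of_dominated_convergence (fun _ => (1 : ℝ))
      · exact Eventually.of_forall fun p => (by fun_prop : Continuous fun t =>
          (f p.1 t - f p.2 t) ^ 2).aestronglyMeasurable
      · refine Eventually.of_forall fun p => Eventually.of_forall fun t => ?_
        rw [Real.norm_of_nonneg (sq_nonneg _)]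
        have := f0 p.1 t; have := f0 p.2 t; have := f1 p.1 t; have := f1 p.2 t
        rw [sq_le_one_iff_abs_le_one, abs_le]
        constructor <;> linarith
      · exact integrable_const _
      · refine Eventually.of_forall fun t => ?_
        rw [← prod_atTop_atTop_eq]
        have := (((ft t).comp tendsto_fst).sub ((ft t).comp (tendsto_snd (f := atTop)))).pow 2
        simpa using this
    have := (Real.continuous_sqrt.tendsto _).comp h0
    simpa [Function.comp_def] using this
  · intro x
    have h : Tendsto (fun n => ∫ t, f n t ∂(scalarSpectralMeasure A hA x)) atTop
        (𝓝 (∫ t, F.indicator (fun _ => (1 : ℝ)) t ∂(scalarSpectralMeasure A hA x))) := by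
      apply tendsto_integral_of_dominated_convergence (fun _ => (1 : ℝ))
      · exact fun n => (f n).continuous.aestronglyMeasurable
      · exact integrable_const _
      · refine fun n => Eventually.of_forall fun t => ?_
        rw [Real.norm_of_nonneg (f0 n t)]; exact f1 n t
      · exact Eventually.of_forall ft
    rw [hind] at h
    simp only [← integral_scalarSpectralMeasure']
    exact (Complex.continuous_ofReal.tendsto _).comp h
  · intro x
    have h : Tendsto (fun n => ∫ t, (f n t) ^ 2 ∂(scalarSpectralMeasure A hA x)) atTop
        (𝓝 (∫ t, F.indicator (fun _ => (1 : ℝ)) t ∂(scalarSpectralMeasure A hA x))) := by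
      apply tendsto_integral_of_dominated_convergence (fun _ => (1 : ℝ))
      · exact fun n => ((f n).continuous.pow 2).aestronglyMeasurable
      · exact integrable_const _
      · refine fun n => Eventually.of_forall fun t => ?_
        rw [Real.norm_of_nonneg (sq_nonneg _)]; exact fsq n t
      · refine Eventually.of_forall fun t => ?_
        have := (ft t).pow 2
        by_cases ht : t ∈ F <;> simpa [ht] using this
    rw [hind] at h
    simpa only [integral_sq_scalarSpectralMeasure] using h

theorem represents_iUnion (A : H →L[ℂ] H) (hA : IsSelfAdjoint A) (S : ℕ → Set (spectrum ℝ A))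
    (hS : ∀ n, MeasurableSet (S n)) (hd : Pairwise (Function.onFun Disjoint S))
    (T : ℕ → H →L[ℂ] H) (hT : ∀ n, Represents A hA (S n) (T n)) :
    ∃ T', Represents A hA (⋃ n, S n) T' ∧ ∀ x, HasSum (fun n => T n x) (T' x) := by
  have horth : ∀ i j, i ≠ j → ∀ x, T i (T j x) = 0 := by
    intro i j hij x
    have h1 := (hT i).norm_sq (T j x)
    have h2 := (hT j).norm_sq (T j x)
    have h3 : T j (T j x) = T j x := DFunLike.congr_fun (hT j).1.isIdempotentElem x
    have h4 := measureReal_union (μ := scalarSpectralMeasure A hA (T j x)) (hd hij) (hS j)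
    have h5 := measureReal_mono (μ := scalarSpectralMeasure A hA (T j x))
      (subset_univ (S i ∪ S j))
    rw [scalarSpectralMeasure_univ, h4, ← h1, ← h2, h3] at h5
    have : ‖T i (T j x)‖ ^ 2 = 0 := le_antisymm (by linarith) (sq_nonneg _)
    simpa using this
  have horth' : ∀ i j, i ≠ j → ∀ x y, ⟪T i x, T j y⟫_ℂ = 0 := by
    intro i j hij x y
    have : ⟪T i x, T j y⟫_ℂ = ⟪x, T i (T j y)⟫_ℂ := (hT i).1.isSelfAdjoint.isSymmetric x (T j y)
    rw [this, horth i j hij, inner_zero_right]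
  have hmeas : ∀ x, HasSum (fun n => (scalarSpectralMeasure A hA x).real (S n))
      ((scalarSpectralMeasure A hA x).real (⋃ n, S n)) := fun x => by
    have h := measure_iUnion (μ := scalarSpectralMeasure A hA x) hd hS
    have hne : ∑' n, (scalarSpectralMeasure A hA x) (S n) ≠ ⊤ := h ▸ measure_ne_top _ _
    have h2 := (ENNReal.summable_toReal hne).hasSum
    rw [← ENNReal.tsum_toReal_eq (fun n => measure_ne_top _ _), ← h] at h2
    exact h2
  have hsum : ∀ x, Summable fun n => T n x := by
    intro x
    have hV : OrthogonalFamily ℂ (fun n => LinearMap.range (T n).toLinearMap)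
        (fun n => (LinearMap.range (T n).toLinearMap).subtypeₗᵢ) := by
      rintro i j hij ⟨_, ⟨v, rfl⟩⟩ ⟨_, ⟨w, rfl⟩⟩
      exact horth' i j hij v w
    refine (hV.summable_iff_norm_sq_summable (fun n => ⟨T n x, ⟨x, rfl⟩⟩)).2 ?_
    simpa [(hT _).norm_sq] using (hmeas x).summable
  have hP : ∀ n x, ⟪(∑ i ∈ Finset.range n, T i) x, x⟫_ℂ
      = ((∑ i ∈ Finset.range n, (scalarSpectralMeasure A hA x).real (S i) : ℝ) : ℂ) := by
    intro n x
    rw [_root_.sum_apply, sum_inner]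
    push_cast
    exact Finset.sum_congr rfl fun i _ => (hT i).2 x
  have hP2 : ∀ n x, ‖(∑ i ∈ Finset.range n, T i) x‖ ^ 2
      = ∑ i ∈ Finset.range n, (scalarSpectralMeasure A hA x).real (S i) := by
    intro n x
    have hsp : IsStarProjection (∑ i ∈ Finset.range n, T i) := by
      apply IsStarProjection.mk
      · change _ * _ = _
        rw [Finset.sum_mul_sum]
        refine Finset.sum_congr rfl fun i hi => ?_
        rw [Finset.sum_eq_single i]
        · exact (hT i).1.isIdempotentElem
        · intro j _ hji
          ext y
          exact horth i j hji.symm y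
        · exact fun h => absurd hi h
      · exact isSelfAdjoint_sum _ fun i _ => (hT i).1.isSelfAdjoint
    have h1 := inner_eq_norm_sq_of_isStarProjection hsp x
    rw [hP] at h1
    exact_mod_cast h1.symm
  obtain ⟨T', hT', hlim⟩ := represents_of_tendsto A hA (⋃ n, S n)
    (fun n => ∑ i ∈ Finset.range n, T i)
    (fun x => by
      simpa only [_root_.sum_apply] using
        (hsum x).hasSum.tendsto_sum_nat.cauchySeq)
    (fun x => by
      simp only [hP]
      exact (Complex.continuous_ofReal.tendsto _).comp (hmeas x).tendsto_sum_nat)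
    (fun x => by
      simp only [hP2]
      exact (hmeas x).tendsto_sum_nat)
  refine ⟨T', hT', fun x => ?_⟩
  have h := (hsum x).hasSum
  have h2 := hlim x
  simp only [_root_.sum_apply] at h2
  rwa [tendsto_nhds_unique h.tendsto_sum_nat h2] at h

theorem represents_univ (A : H →L[ℂ] H) (hA : IsSelfAdjoint A) :
    Represents A hA univ 1 := by
  refine ⟨IsStarProjection.one _, fun x => ?_⟩
  rw [scalarSpectralMeasure_univ, one_apply_eq_self, inner_self_eq_norm_sq_to_K]
  simp

theorem exists_represents (A : H →L[ℂ] H) (hA : IsSelfAdjoint A)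
    (S : Set (spectrum ℝ A)) (hS : MeasurableSet S) : ∃ T, Represents A hA S T := by
  refine MeasurableSpace.induction_on_inter (C := fun S _ => ∃ T, Represents A hA S T)
    (BorelSpace.measurable_eq.trans borel_eq_generateFrom_isClosed) isPiSystem_isClosed
    ?_ ?_ ?_ ?_ S hS
  · exact ⟨0, IsStarProjection.zero _, fun x => by simp⟩
  · exact fun F hF => exists_represents_isClosed A hA F hF
  · rintro S hS ⟨T, hT⟩
    refine ⟨1 - T, hT.1.one_sub, fun x => ?_⟩
    rw [_root_.sub_apply, inner_sub_left, hT.2, (represents_univ A hA).2,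
      measureReal_compl hS]
    push_cast
    rfl
  · intro S hd hS h
    choose T hT using h
    obtain ⟨T', hT', -⟩ := represents_iUnion A hA S hS hd T hT
    exact ⟨T', hT'⟩

open Classical in
/-- For Borel `S`, the unique orthogonal projection `P` with
`⟪P x, x⟫ = μ_x(S)` for all `x`, where `μ_x` is the scalar spectral measure of `A` at `x`. -/
def spectralProjection (A : H →L[ℂ] H) (hA : IsSelfAdjoint A) (S : Set (spectrum ℝ A)) :
    H →L[ℂ] H :=
  if hS : MeasurableSet S then (exists_represents A hA S hS).choose else 0

theorem represents_spectralProjection (A : H →L[ℂ] H) (hA : IsSelfAdjoint A)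
    (S : Set (spectrum ℝ A)) (hS : MeasurableSet S) :
    Represents A hA S (spectralProjection A hA S) := by
  rw [spectralProjection, dif_pos hS]
  exact (exists_represents A hA S hS).choose_spec

/-- The spectral measure `E_A` of a bounded self-adjoint operator `A`. -/
def spectralMeasure (A : H →L[ℂ] H) (hA : IsSelfAdjoint A) : ProjectionValuedMeasure H where
  proj S := spectralProjection A hA (Subtype.val ⁻¹' S)
  isStarProjection S hS :=
    (represents_spectralProjection A hA _ (measurable_subtype_coe hS)).1
  univ := (represents_spectralProjection A hA _ (measurable_subtype_coe .univ)).unique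
    (represents_univ A hA)
  hasSum_iUnion S hS hd x := by
    obtain ⟨T', hT', h⟩ := represents_iUnion A hA (fun n => Subtype.val ⁻¹' S n)
      (fun n => measurable_subtype_coe (hS n))
      (fun i j hij => (hd hij).preimage _) _
      (fun n => represents_spectralProjection A hA _ (measurable_subtype_coe (hS n)))
    have hm : MeasurableSet (⋃ n, (Subtype.val ⁻¹' S n : Set (spectrum ℝ A))) :=
      .iUnion fun n => measurable_subtype_coe (hS n)
    rw [preimage_iUnion, (represents_spectralProjection A hA _ hm).unique hT']
    exact h x

/-- `A = ∫ t dE_A(t)`: for every `x`, the set function `S ↦ ⟪E_A(S) x, x⟫` is a finite Borel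
measure on `ℝ` carried by the spectrum of `A`, with first moment `⟪A x, x⟫`. -/
theorem spectralMeasure_spec (A : H →L[ℂ] H) (hA : IsSelfAdjoint A) (x : H) :
    ∃ μ : Measure ℝ, IsFiniteMeasure μ ∧ μ (spectrum ℝ A)ᶜ = 0 ∧
      (∀ S, MeasurableSet S → ⟪(spectralMeasure A hA).proj S x, x⟫_ℂ = (μ.real S : ℂ)) ∧
      Integrable (fun t => t) μ ∧ ⟪A x, x⟫_ℂ = ((∫ t, t ∂μ : ℝ) : ℂ) := by
  have hK : MeasurableSet (spectrum ℝ A) := (spectrum.isCompact A).measurableSet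
  refine ⟨(scalarSpectralMeasure A hA x).map Subtype.val, inferInstance, ?_, ?_, ?_, ?_⟩
  · rw [Measure.map_apply measurable_subtype_coe hK.compl]
    simp
  · intro S hS
    rw [map_measureReal_apply measurable_subtype_coe hS]
    exact (represents_spectralProjection A hA _ (measurable_subtype_coe hS)).2 x
  · rw [integrable_map_measure (by fun_prop) (by fun_prop)]
    exact (ContinuousMap.restrict (spectrum ℝ A) (.id ℝ)).continuous.integrable_of_hasCompactSupport
      (HasCompactSupport.of_compactSpace _)
  · rw [integral_map (by fun_prop) (by fun_prop)]
    have h := integral_scalarSpectralMeasure' A hA x (ContinuousMap.restrict (spectrum ℝ A) (.id ℝ))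
    rw [cfcHom_id hA] at h
    exact h.symm

/-- The subspace `H_ε = ⋂ᵢ E_{Aᵢ}([-ε, ε]) H`. -/
def commonSpectralSubspace {N : ℕ} (A : Fin N → H →L[ℂ] H) (hA : ∀ i, IsSelfAdjoint (A i))
    (ε : ℝ) : Submodule ℂ H :=
  ⨅ i, LinearMap.range ((spectralMeasure (A i) (hA i)).proj (Icc (-ε) ε)).toLinearMap

end Construction

end SpectralSum

end

/-! For self-adjoint `A`, Weyl's criterion says that `0 ∈ σₑ(A)` exactly when `A` has a singular
sequence at `0`: orthogonally to every finite-dimensional subspace there are vectors on which `A` is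
arbitrarily small. On `H_ε` the sum `A = ∑ᵢ Aᵢ` is bounded by `N ε`, so infinite-dimensional `H_ε`
for all `ε` yield such vectors.

Conversely, fix `ε` and let `Pᵢ = 1 - E_{Aᵢ}([-ε, ε])`. Inverting `Aᵢ` on the range of `Pᵢ` gives
`Pᵢ = Wᵢ Aᵢ` with `Wᵢ = Vᵢ Aᵢ`, so `Pᵢ - Wᵢ A = -∑_{j ≠ i} Vᵢ Aᵢ Aⱼ` and `Pᵢ Pⱼ = Wᵢ Aᵢ Aⱼ Wⱼ†` are
compact. Hence a singular sequence for `A` is also one for `T = (Pᵢ)ᵢ : H → ⨁ᵢ ran Pᵢ`. Since `T T†`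
is a compact perturbation of the identity, `T` has a generalized inverse, and a singular sequence
then forces `ker T = ⋂ᵢ ker Pᵢ = H_ε` to be infinite-dimensional. -/

namespace SpectralSum

section Singular

variable {𝕜 E F G : Type*} [RCLike 𝕜]
  [NormedAddCommGroup E] [InnerProductSpace 𝕜 E]
  [NormedAddCommGroup F] [NormedSpace 𝕜 F]
  [NormedAddCommGroup G] [NormedSpace 𝕜 G]

/-- An operator is *Weyl singular* if it is not bounded below on the orthogonal complement of any
finite-dimensional subspace. This is the existence of a singular Weyl sequence (unit vectors
`xₙ ⇀ 0` with `T xₙ → 0`), phrased without sequences. -/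
def IsWeylSingular (T : E →L[𝕜] F) : Prop :=
  ∀ M : Submodule 𝕜 E, FiniteDimensional 𝕜 M → ∀ δ : ℝ, 0 < δ →
    ∃ x ∈ Mᗮ, x ≠ 0 ∧ ‖T x‖ ≤ δ * ‖x‖

theorem not_isWeylSingular_one : ¬ IsWeylSingular (1 : E →L[𝕜] E) := by
  intro h
  obtain ⟨x, -, hx0, hx⟩ := h ⊥ inferInstance (1 / 2) (by norm_num)
  rw [one_apply_eq_self] at hx
  linarith [norm_pos_iff.2 hx0]

theorem IsWeylSingular.clm_comp {T : E →L[𝕜] F} (hT : IsWeylSingular T) (S : F →L[𝕜] G) :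
    IsWeylSingular (S ∘L T) := by
  intro M hM δ hδ
  obtain ⟨x, hxM, hx0, hx⟩ := hT M hM (δ / (‖S‖ + 1)) (by positivity)
  refine ⟨x, hxM, hx0, ?_⟩
  calc ‖S (T x)‖ ≤ (‖S‖ + 1) * (δ / (‖S‖ + 1) * ‖x‖) := by
        refine (S.le_opNorm _).trans ?_
        gcongr
        linarith
    _ = δ * ‖x‖ := by field_simp

theorem exists_mem_orthogonal_ne_zero_of_not_finiteDimensional {L M : Submodule 𝕜 E}
    (hL : ¬ FiniteDimensional 𝕜 L) [FiniteDimensional 𝕜 M] : ∃ x ∈ L, x ∈ Mᗮ ∧ x ≠ 0 := by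
  by_contra! h
  let φ : L →ₗ[𝕜] M := M.orthogonalProjectionOnto.toLinearMap ∘ₗ L.subtype
  have hφ : LinearMap.ker φ = ⊥ := (Submodule.eq_bot_iff _).2 fun x hx =>
    Subtype.ext (h x x.2 (Submodule.orthogonalProjectionOnto_eq_zero_iff.1 hx))
  exact hL (FiniteDimensional.of_injective φ (LinearMap.ker_eq_bot.1 hφ))

theorem isWeylSingular_of_forall_exists_submodule {T : E →L[𝕜] F}
    (h : ∀ δ : ℝ, 0 < δ → ∃ L : Submodule 𝕜 E, ¬ FiniteDimensional 𝕜 L ∧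
      ∀ x ∈ L, ‖T x‖ ≤ δ * ‖x‖) : IsWeylSingular T := by
  intro M hM δ hδ
  obtain ⟨L, hL, hTL⟩ := h δ hδ
  obtain ⟨x, hxL, hxM, hx0⟩ := exists_mem_orthogonal_ne_zero_of_not_finiteDimensional (M := M) hL
  exact ⟨x, hxM, hx0, hTL x hxL⟩

theorem isWeylSingular_of_not_finiteDimensional_ker {T : E →L[𝕜] F}
    (h : ¬ FiniteDimensional 𝕜 (LinearMap.ker T.toLinearMap)) : IsWeylSingular T :=
  isWeylSingular_of_forall_exists_submodule fun δ hδ => ⟨_, h, fun x hx => by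
    rw [show T x = 0 from hx, norm_zero]; positivity⟩

/-- For `x ⟂ ker T`, the vector `x - R T x` lies in `ker T`, so `‖x‖² = ⟪x, R T x⟫`: the
generalized inverse bounds `T` from below on `(ker T)ᗮ`. -/
theorem IsWeylSingular.not_finiteDimensional_ker {T : E →L[𝕜] F} (hT : IsWeylSingular T)
    {R : F →L[𝕜] E} (hR : T ∘L R ∘L T = T) :
    ¬ FiniteDimensional 𝕜 (LinearMap.ker T.toLinearMap) := by
  intro hfin
  obtain ⟨x, hxK, hx0, hx⟩ := hT _ hfin (1 / (2 * (‖R‖ + 1))) (by positivity)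
  have hker : x - R (T x) ∈ LinearMap.ker T.toLinearMap := by
    rw [LinearMap.mem_ker, map_sub, sub_eq_zero]
    exact (DFunLike.congr_fun hR x).symm
  have hinner : ⟪x, R (T x)⟫_𝕜 = ⟪x, x⟫_𝕜 := by
    have := Submodule.inner_left_of_mem_orthogonal hker hxK
    rw [inner_sub_right, sub_eq_zero] at this
    exact this.symm
  have hpos : 0 < ‖x‖ := norm_pos_iff.2 hx0
  have hle : ‖x‖ * ‖x‖ ≤ ‖x‖ * ‖R (T x)‖ := by
    rw [← inner_self_eq_norm_mul_norm (𝕜 := 𝕜), ← hinner]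
    exact re_inner_le_norm x (R (T x))
  have : ‖x‖ ≤ ‖x‖ / 2 := calc
    ‖x‖ ≤ ‖R (T x)‖ := le_of_mul_le_mul_left hle hpos
    _ ≤ (‖R‖ + 1) * (1 / (2 * (‖R‖ + 1)) * ‖x‖) := by
        refine (R.le_opNorm _).trans ?_
        gcongr
        linarith
    _ = ‖x‖ / 2 := by field_simp
  linarith

end Singular

section Compact

variable {𝕜 E F : Type*} [RCLike 𝕜]
  [NormedAddCommGroup E] [InnerProductSpace 𝕜 E] [CompleteSpace E]
  [NormedAddCommGroup F] [InnerProductSpace 𝕜 F] [CompleteSpace F]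

/-- If `t` is a `δ`-net of the image of the unit ball, then `M = span (K† t)` works: for a unit
vector `u ⟂ M` one has `K u ⟂ t`, so `K u` is at distance at least `‖K u‖` from every point
of `t`. -/
theorem exists_finiteDimensional_norm_le_of_isCompactOperator {K : E →L[𝕜] F}
    (hK : IsCompactOperator K) {δ : ℝ} (hδ : 0 < δ) :
    ∃ M : Submodule 𝕜 E, FiniteDimensional 𝕜 M ∧ ∀ x ∈ Mᗮ, ‖K x‖ ≤ δ * ‖x‖ := by
  obtain ⟨C, hC, hKC⟩ :=
    IsCompactOperator.image_closedBall_subset_compact (f := K.toLinearMap) hK 1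
  obtain ⟨t, ht, hCt⟩ := Metric.totallyBounded_iff.1 hC.totallyBounded δ hδ
  set M : Submodule 𝕜 E := Submodule.span 𝕜 (K.adjoint '' t)
  have hunit (u : Mᗮ) (hu : ‖u‖ = 1) : ‖K u‖ ≤ δ := by
    obtain ⟨y, hyt, hy⟩ := mem_iUnion₂.1 (hCt (hKC ⟨u, by simpa using hu.le, rfl⟩))
    have horth : ⟪K u, y⟫_𝕜 = 0 := by
      rw [← ContinuousLinearMap.adjoint_inner_right]
      exact Submodule.inner_left_of_mem_orthogonal
        (Submodule.subset_span (mem_image_of_mem _ hyt)) u.2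
    have hpyth : ‖K u - y‖ ^ 2 = ‖K u‖ ^ 2 + ‖y‖ ^ 2 := by
      rw [norm_sub_sq (𝕜 := 𝕜), horth, map_zero, mul_zero, sub_zero]
    calc ‖K u‖ ≤ ‖K u - y‖ := by
          refine le_of_sq_le_sq ?_ (norm_nonneg _)
          linarith [sq_nonneg ‖y‖]
      _ ≤ δ := by rw [← dist_eq_norm]; exact (Metric.mem_ball.1 hy).le
  have hnorm : ‖K ∘L Mᗮ.subtypeL‖ ≤ δ :=
    ContinuousLinearMap.opNorm_le_of_unit_norm hδ.le hunit
  exact ⟨M, FiniteDimensional.span_of_finite 𝕜 (ht.image _), fun x hx =>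
    (K ∘L Mᗮ.subtypeL).le_of_opNorm_le hnorm ⟨x, hx⟩⟩

theorem IsWeylSingular.add_isCompactOperator {T K : E →L[𝕜] F} (hT : IsWeylSingular T)
    (hK : IsCompactOperator K) : IsWeylSingular (T + K) := by
  intro M hM δ hδ
  obtain ⟨M', hM', hKM'⟩ := exists_finiteDimensional_norm_le_of_isCompactOperator hK (half_pos hδ)
  obtain ⟨x, hx, hx0, hTx⟩ := hT (M ⊔ M') inferInstance (δ / 2) (half_pos hδ)
  refine ⟨x, Submodule.orthogonal_le le_sup_left hx, hx0, ?_⟩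
  have hKx := hKM' x (Submodule.orthogonal_le le_sup_right hx)
  calc ‖T x + K x‖ ≤ δ / 2 * ‖x‖ + δ / 2 * ‖x‖ := norm_add_le_of_le hTx hKx
    _ = δ * ‖x‖ := by ring

end Compact

section FiniteRank

variable {𝕜 E F : Type*} [NontriviallyNormedField 𝕜] [LocallyCompactSpace 𝕜]
  [NormedAddCommGroup E] [NormedSpace 𝕜 E] [NormedAddCommGroup F] [NormedSpace 𝕜 F]

theorem isCompactOperator_of_finiteDimensional_range (T : E →L[𝕜] F)
    [FiniteDimensional 𝕜 (LinearMap.range T.toLinearMap)] : IsCompactOperator T := by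
  have : ProperSpace (LinearMap.range T.toLinearMap) := FiniteDimensional.proper 𝕜 _
  exact (isCompactOperator_of_locallyCompactSpace_dom
    (T.codRestrict (LinearMap.range T.toLinearMap) fun x => ⟨x, rfl⟩)).clm_comp
      (LinearMap.range T.toLinearMap).subtypeL

theorem finite_spectrum_of_finiteDimensional_range [CompleteSpace E] (T : E →L[𝕜] E)
    [FiniteDimensional 𝕜 (LinearMap.range T.toLinearMap)] : (spectrum 𝕜 T).Finite := by
  have hK := isCompactOperator_of_finiteDimensional_range T
  have heig (μ : ↥(spectrum 𝕜 T \ {0})) : ∃ x, Module.End.HasEigenvector T.toLinearMap μ x :=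
    ((hK.hasEigenvalue_iff_mem_spectrum μ.2.2).2 μ.2.1).exists_hasEigenvector
  choose v hv using heig
  have hrange (μ) : v μ ∈ LinearMap.range T.toLinearMap :=
    ⟨(μ : 𝕜)⁻¹ • v μ, by
      rw [map_smul, (hv μ).apply_eq_smul, inv_smul_smul₀ μ.2.2]⟩
  have hlin : LinearIndependent 𝕜 fun μ => (⟨v μ, hrange μ⟩ : LinearMap.range T.toLinearMap) :=
    .of_comp (LinearMap.range T.toLinearMap).subtype
      (Module.End.eigenvectors_linearIndependent _ _ v hv)
  have hfin : (spectrum 𝕜 T \ {0}).Finite := Set.finite_coe_iff.1 hlin.finite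
  exact (hfin.union (finite_singleton 0)).subset (by simp)

end FiniteRank

section FunctionalCalculus

variable {H : Type*} [NormedAddCommGroup H] [InnerProductSpace ℂ H] [CompleteSpace H]

/-- The signed amount by which `t` exceeds the interval `[-ε, ε]`: zero on the interval,
`t - ε` above it and `t + ε` below it. -/
def excess (ε t : ℝ) : ℝ := t - max (-ε) (min t ε)

/-- The reciprocal of `t`, truncated to a continuous function: it is `t⁻¹` for `ε ≤ |t|` and
`t / ε ^ 2` for `|t| ≤ ε`. -/
noncomputable def truncatedInv (ε t : ℝ) : ℝ := t / max (t ^ 2) (ε ^ 2)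

@[fun_prop]
theorem continuous_excess (ε : ℝ) : Continuous (excess ε) := by
  unfold excess
  fun_prop

theorem excess_eq_zero_iff {ε : ℝ} (hε : 0 ≤ ε) (t : ℝ) : excess ε t = 0 ↔ t ∈ Icc (-ε) ε := by
  rw [excess, sub_eq_zero, mem_Icc]
  constructor
  · intro h
    exact ⟨h ▸ le_max_left _ _, h ▸ max_le (by linarith) (min_le_right _ _)⟩
  · rintro ⟨h₁, h₂⟩
    rw [min_eq_left h₂, max_eq_right h₁]

theorem abs_sub_excess_le {ε : ℝ} (hε : 0 ≤ ε) (t : ℝ) : |t - excess ε t| ≤ ε := by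
  rw [excess, sub_sub_cancel, abs_le]
  exact ⟨le_max_left _ _, max_le (by linarith) (min_le_right _ _)⟩

theorem continuous_truncatedInv {ε : ℝ} (hε : 0 < ε) : Continuous (truncatedInv ε) := by
  have hpos (t : ℝ) : 0 < max (t ^ 2) (ε ^ 2) := lt_max_of_lt_right (by positivity)
  exact continuous_id.div (by fun_prop) fun t => (hpos t).ne'

theorem truncatedInv_mul_self {ε t : ℝ} (hε : 0 < ε) (ht : ε ≤ |t|) :
    truncatedInv ε t * t = 1 := by
  have hsq : ε ^ 2 ≤ t ^ 2 := sq_le_sq.2 (by rwa [abs_of_pos hε])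
  have ht0 : t ≠ 0 := abs_pos.1 (hε.trans_le ht)
  rw [truncatedInv, max_eq_left hsq]
  field_simp

theorem norm_apply_le_of_mem_ker_cfc_excess {A : H →L[ℂ] H} (hA : IsSelfAdjoint A) {ε : ℝ}
    (hε : 0 ≤ ε) {x : H} (hx : x ∈ LinearMap.ker (cfc (excess ε) A).toLinearMap) :
    ‖A x‖ ≤ ε * ‖x‖ := by
  have hclamp : cfc (fun t => t - excess ε t) A = A - cfc (excess ε) A := by
    rw [cfc_sub _ _ A, cfc_id' ℝ A]
  have hAx : A x = cfc (fun t => t - excess ε t) A x := by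
    rw [hclamp, _root_.sub_apply, show cfc (excess ε) A x = 0 from hx, sub_zero]
  rw [hAx]
  exact ContinuousLinearMap.le_of_opNorm_le _
    (norm_cfc_le hε fun t _ => abs_sub_excess_le hε t) x

theorem cfc_excess_comp_eq_zero (A : H →L[ℂ] H) {ε : ℝ} (hε : 0 ≤ ε) {f : ℝ → ℝ}
    (hf : Continuous f) (hf0 : ∀ t, ε ≤ |t| → f t = 0) :
    cfc (excess ε) A ∘L cfc f A = 0 := by
  change cfc (excess ε) A * cfc f A = 0
  rw [← cfc_mul _ _ A, ← cfc_const_zero ℝ A]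
  refine cfc_congr fun t _ => ?_
  rcases le_total ε |t| with ht | ht
  · exact mul_eq_zero_of_right _ (hf0 t ht)
  · exact mul_eq_zero_of_left ((excess_eq_zero_iff hε t).2 (abs_le.1 ht)) _

theorem cfc_one_sub_truncatedInv_mul {A : H →L[ℂ] H} (hA : IsSelfAdjoint A) {ε : ℝ}
    (hε : 0 < ε) :
    cfc (fun t => 1 - truncatedInv ε t * t) A = 1 - cfc (truncatedInv ε) A ∘L A := by
  have hcont := continuous_truncatedInv hε
  rw [cfc_sub _ _ A, cfc_mul _ _ A, cfc_id' ℝ A, cfc_const_one ℝ A]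
  rfl

end FunctionalCalculus

section SpectralMeasure

variable {H : Type*} [NormedAddCommGroup H] [InnerProductSpace ℂ H] [CompleteSpace H]

theorem scalarSpectralMeasure_compl_eq_zero_iff_mem_range_proj {A : H →L[ℂ] H}
    (hA : IsSelfAdjoint A) {S : Set ℝ} (hS : MeasurableSet S) (x : H) :
    scalarSpectralMeasure A hA x (Subtype.val ⁻¹' S)ᶜ = 0 ↔
      x ∈ LinearMap.range ((spectralMeasure A hA).proj S).toLinearMap := by
  have hS' : MeasurableSet (Subtype.val ⁻¹' S : Set (spectrum ℝ A)) := measurable_subtype_coe hS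
  have hrep := represents_spectralProjection A hA _ hS'
  have hcompl : Represents A hA (Subtype.val ⁻¹' S)ᶜ (1 - (spectralMeasure A hA).proj S) := by
    refine ⟨hrep.1.one_sub, fun y => ?_⟩
    rw [_root_.sub_apply, inner_sub_left, (represents_univ A hA).2, measureReal_compl hS',
      Complex.ofReal_sub]
    exact congrArg _ (hrep.2 y)
  have hidem : IsIdempotentElem ((spectralMeasure A hA).proj S).toLinearMap :=
    ContinuousLinearMap.isIdempotentElem_toLinearMap_iff.2 hrep.1.isIdempotentElem
  rw [← measureReal_eq_zero_iff, ← hcompl.norm_sq, sq_eq_zero_iff, norm_eq_zero,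
    _root_.sub_apply, one_apply_eq_self, sub_eq_zero,
    LinearMap.IsIdempotentElem.mem_range_iff hidem, eq_comm]
  rfl

theorem scalarSpectralMeasure_eq_zero_iff_cfc_apply_eq_zero {A : H →L[ℂ] H}
    (hA : IsSelfAdjoint A) {f : ℝ → ℝ} (hf : ContinuousOn f (spectrum ℝ A)) (x : H) :
    scalarSpectralMeasure A hA x {t | f t ≠ 0} = 0 ↔ cfc f A x = 0 := by
  rw [cfc_apply f A hA hf, ← norm_eq_zero, ← sq_eq_zero_iff (a := ‖_‖),
    ← integral_sq_scalarSpectralMeasure,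
    integral_eq_zero_iff_of_nonneg (fun t => sq_nonneg _)
      ((ContinuousMap.continuous _).pow 2 |>.integrable_of_hasCompactSupport (.of_compactSpace _)),
    Filter.EventuallyEq, ae_iff]
  simp

theorem range_proj_eq_ker_cfc {A : H →L[ℂ] H} (hA : IsSelfAdjoint A) {S : Set ℝ}
    (hS : MeasurableSet S) {f : ℝ → ℝ} (hf : ContinuousOn f (spectrum ℝ A))
    (hfS : ∀ t ∈ spectrum ℝ A, f t = 0 ↔ t ∈ S) :
    LinearMap.range ((spectralMeasure A hA).proj S).toLinearMap =
      LinearMap.ker (cfc f A).toLinearMap := by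
  ext x
  have hset : (Subtype.val ⁻¹' S : Set (spectrum ℝ A))ᶜ = {t : spectrum ℝ A | f t ≠ 0} := by
    ext t
    exact not_congr (hfS t t.2).symm
  rw [← scalarSpectralMeasure_compl_eq_zero_iff_mem_range_proj hA hS, hset,
    scalarSpectralMeasure_eq_zero_iff_cfc_apply_eq_zero hA hf]
  rfl

theorem range_proj_Icc_eq_ker_cfc_excess {A : H →L[ℂ] H} (hA : IsSelfAdjoint A) {ε : ℝ}
    (hε : 0 ≤ ε) :
    LinearMap.range ((spectralMeasure A hA).proj (Icc (-ε) ε)).toLinearMap =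
      LinearMap.ker (cfc (excess ε) A).toLinearMap :=
  range_proj_eq_ker_cfc hA measurableSet_Icc (continuous_excess ε).continuousOn
    fun t _ => excess_eq_zero_iff hε t

theorem norm_apply_le_of_mem_range_proj_Icc {A : H →L[ℂ] H} (hA : IsSelfAdjoint A) {ε : ℝ}
    (hε : 0 ≤ ε) {x : H}
    (hx : x ∈ LinearMap.range ((spectralMeasure A hA).proj (Icc (-ε) ε)).toLinearMap) :
    ‖A x‖ ≤ ε * ‖x‖ :=
  norm_apply_le_of_mem_ker_cfc_excess hA hε (range_proj_Icc_eq_ker_cfc_excess hA hε ▸ hx)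

/-- With `P = 1 - E([-ε, ε])` and `R` the truncated inverse of `A`, one has `P R A = P`; since `R`
commutes with `A`, the operators `W = P R` and `V = P R R` work. -/
theorem exists_comp_eq_one_sub_proj_Icc {A : H →L[ℂ] H} (hA : IsSelfAdjoint A) {ε : ℝ}
    (hε : 0 < ε) :
    ∃ W V : H →L[ℂ] H,
      W ∘L A = 1 - (spectralMeasure A hA).proj (Icc (-ε) ε) ∧ V ∘L A = W := by
  set E := (spectralMeasure A hA).proj (Icc (-ε) ε) with hE
  set R := cfc (truncatedInv ε) A
  have hcomm : R * A = A * R := (Commute.refl A).cfc_real _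
  have hidem : IsIdempotentElem E :=
    ((spectralMeasure A hA).isStarProjection _ measurableSet_Icc).isIdempotentElem
  have hzero : (1 - E) * (1 - R * A) = 0 := by
    ext x
    have hmem : (1 - R * A) x ∈ LinearMap.range E.toLinearMap := by
      have hexcess := cfc_excess_comp_eq_zero A hε.le (f := fun t => 1 - truncatedInv ε t * t)
        (by have := continuous_truncatedInv hε; fun_prop)
        fun t ht => sub_eq_zero.2 (truncatedInv_mul_self hε ht).symm
      rw [cfc_one_sub_truncatedInv_mul hA hε] at hexcess
      rw [hE, range_proj_Icc_eq_ker_cfc_excess hA hε.le]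
      exact DFunLike.congr_fun hexcess x
    obtain ⟨y, hy⟩ := hmem
    rw [mul_apply_eq_comp, ← hy]
    exact DFunLike.congr_fun hidem.one_sub_mul_self y
  have hPRA : (1 - E) * (R * A) = 1 - E := by
    rwa [mul_sub, mul_one, sub_eq_zero, eq_comm] at hzero
  refine ⟨(1 - E) * R, (1 - E) * R * R, (mul_assoc _ _ _).trans hPRA, ?_⟩
  calc (1 - E) * R * R * A = (1 - E) * (R * A) * R := by
        simp only [mul_assoc, ← hcomm]
    _ = (1 - E) * R := by rw [hPRA]

end SpectralMeasure

section WeylCriterion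

variable {H : Type*} [NormedAddCommGroup H] [InnerProductSpace ℂ H] [CompleteSpace H]

theorem infinite_spectrum_inter_Ioo_of_accPt {A : H →L[ℂ] H} (hA : IsSelfAdjoint A)
    (h : AccPt (0 : ℂ) (𝓟 (spectrum ℂ A))) {δ : ℝ} (hδ : 0 < δ) :
    (spectrum ℝ A ∩ Ioo (-δ) δ).Infinite := by
  have hball : (Metric.ball 0 δ ∩ spectrum ℂ A).Infinite :=
    .of_accPt (h.nhds_inter (Metric.ball_mem_nhds 0 hδ))
  refine .of_image (algebraMap ℝ ℂ) (hball.mono ?_)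
  rintro z ⟨hzδ, hzA⟩
  rw [← hA.spectrumRestricts.algebraMap_image] at hzA
  obtain ⟨t, ht, rfl⟩ := hzA
  exact mem_image_of_mem _ ⟨ht, by simpa [abs_lt] using hzδ⟩

/-- Otherwise `f(A)`, with `f(t) = max (δ - |t|) 0` supported in `[-δ, δ]`, would have finite rank
and hence finite spectrum, although `f` is two-to-one on `(-δ, δ) \ {0}`. -/
theorem not_finiteDimensional_ker_cfc_excess {A : H →L[ℂ] H} (hA : IsSelfAdjoint A) {δ : ℝ}
    (hδ : 0 ≤ δ) (hinf : (spectrum ℝ A ∩ Ioo (-δ) δ).Infinite) :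
    ¬ FiniteDimensional ℂ (LinearMap.ker (cfc (excess δ) A).toLinearMap) := by
  intro hfin
  let f : ℝ → ℝ := fun t => max (δ - |t|) 0
  have hf : Continuous f := by fun_prop
  have hrange : LinearMap.range (cfc f A).toLinearMap ≤
      LinearMap.ker (cfc (excess δ) A).toLinearMap := by
    rintro _ ⟨x, rfl⟩
    exact DFunLike.congr_fun (cfc_excess_comp_eq_zero A hδ hf fun t ht =>
      max_eq_right (by linarith)) x
  have : FiniteDimensional ℂ (LinearMap.range (cfc f A).toLinearMap) :=
    Submodule.finiteDimensional_of_le hrange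
  have hspec : (f '' spectrum ℝ A).Finite := by
    rw [← cfc_map_spectrum f A, ← spectrum.preimage_algebraMap ℂ]
    exact (finite_spectrum_of_finiteDimensional_range _).preimage
      (FaithfulSMul.algebraMap_injective ℝ ℂ).injOn
  refine hinf ((hspec.biUnion fun c _ => toFinite {δ - c, c - δ}).subset ?_)
  rintro t ⟨htA, htδ⟩
  have hft : f t = δ - |t| := max_eq_left (sub_nonneg.2 (abs_lt.2 htδ).le)
  refine mem_biUnion (mem_image_of_mem f htA) ?_
  rcases abs_choice t with ht | ht <;> simp [hft, ht]

theorem isWeylSingular_of_accPt {A : H →L[ℂ] H} (hA : IsSelfAdjoint A)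
    (h : AccPt (0 : ℂ) (𝓟 (spectrum ℂ A))) : IsWeylSingular A :=
  isWeylSingular_of_forall_exists_submodule fun _ hδ =>
    ⟨_, not_finiteDimensional_ker_cfc_excess hA hδ.le
        (infinite_spectrum_inter_Ioo_of_accPt hA h hδ),
      fun _ hx => norm_apply_le_of_mem_ker_cfc_excess hA hδ.le hx⟩

theorem exists_comp_comp_eq_self_of_not_accPt {A : H →L[ℂ] H} (hA : IsSelfAdjoint A)
    (h : ¬ AccPt (0 : ℂ) (𝓟 (spectrum ℂ A))) : ∃ R : H →L[ℂ] H, A ∘L R ∘L A = A := by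
  obtain ⟨r, hr, hgap⟩ : ∃ r > 0, ∀ t ∈ spectrum ℝ A, t ≠ 0 → r ≤ |t| := by
    rw [accPt_iff_frequently, not_frequently, Metric.eventually_nhds_iff] at h
    obtain ⟨r, hr, hball⟩ := h
    refine ⟨r, hr, fun t ht ht0 => not_lt.1 fun htr => hball (y := (t : ℂ)) (by simpa using htr) ?_⟩
    exact ⟨Complex.ofReal_ne_zero.2 ht0, spectrum.algebraMap_mem ℂ ht⟩
  have hcont := continuous_truncatedInv hr
  have hzero : A ∘L (1 - cfc (truncatedInv r) A ∘L A) = 0 := by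
    rw [← cfc_one_sub_truncatedInv_mul hA hr]
    calc A * cfc (fun t => 1 - truncatedInv r t * t) A
        = cfc (fun t => t * (1 - truncatedInv r t * t)) A := by
          rw [cfc_mul (fun t => t) _ A, cfc_id' ℝ A]
      _ = cfc (fun _ => (0 : ℝ)) A := cfc_congr fun t ht => by
          rcases eq_or_ne t 0 with rfl | ht0
          · exact zero_mul _
          · simp only [truncatedInv_mul_self hr (hgap t ht ht0), sub_self, mul_zero]
      _ = 0 := cfc_const_zero ℝ A
  rw [ContinuousLinearMap.comp_sub, sub_eq_zero] at hzero
  exact ⟨_, hzero.symm⟩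

theorem zero_mem_essentialSpectrum_iff_isWeylSingular {A : H →L[ℂ] H} (hA : IsSelfAdjoint A) :
    (0 : ℂ) ∈ essentialSpectrum A ↔ IsWeylSingular A := by
  have hA0 : A - (0 : ℂ) • (1 : H →L[ℂ] H) = A := by rw [zero_smul, sub_zero]
  rw [essentialSpectrum, mem_ofPred_eq, hA0]
  constructor
  · rintro ⟨-, hacc | hker⟩
    · exact isWeylSingular_of_accPt hA hacc
    · exact isWeylSingular_of_not_finiteDimensional_ker hker
  · intro hsing
    refine ⟨(spectrum.zero_mem_iff ℂ).2 ?_, or_iff_not_imp_left.2 fun hacc => ?_⟩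
    · rintro ⟨u, rfl⟩
      have hone : IsWeylSingular ((↑u⁻¹ : H →L[ℂ] H) * (↑u : H →L[ℂ] H)) := hsing.clm_comp _
      exact not_isWeylSingular_one (u.inv_mul ▸ hone)
    · obtain ⟨R, hR⟩ := exists_comp_comp_eq_self_of_not_accPt hA hacc
      exact hsing.not_finiteDimensional_ker hR

end WeylCriterion

section GramOperator

variable {X H : Type*} [NormedAddCommGroup X] [InnerProductSpace ℂ X] [CompleteSpace X]
  [NormedAddCommGroup H] [InnerProductSpace ℂ H] [CompleteSpace H]

/-- A generalized inverse `R` of `G = T T†` gives the generalized inverse `T† R` of `T`: the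
operator `D = (G R - 1) T` satisfies `D D† = (G R G - G) (G R - 1)† = 0`. -/
theorem comp_comp_eq_self_of_comp_adjoint {T : H →L[ℂ] X} {R : X →L[ℂ] X}
    (hR : (T ∘L T.adjoint) ∘L R ∘L (T ∘L T.adjoint) = T ∘L T.adjoint) :
    T ∘L (T.adjoint ∘L R) ∘L T = T := by
  set D := T ∘L (T.adjoint ∘L R) ∘L T - T with hD
  have hDT : D ∘L T.adjoint = 0 := by
    rw [hD, ContinuousLinearMap.sub_comp, sub_eq_zero]
    exact hR
  have hDD : D.adjoint.adjoint ∘L D.adjoint = 0 := by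
    have hDadj : D.adjoint = T.adjoint ∘L (R.adjoint ∘L (T ∘L T.adjoint) - 1) := by
      simp only [hD, map_sub, ContinuousLinearMap.adjoint_comp,
        ContinuousLinearMap.adjoint_adjoint, ContinuousLinearMap.comp_sub,
        ContinuousLinearMap.comp_assoc]
      rfl
    rw [ContinuousLinearMap.adjoint_adjoint, hDadj, ← ContinuousLinearMap.comp_assoc, hDT,
      ContinuousLinearMap.zero_comp]
  rw [ContinuousLinearMap.adjoint_comp_self_eq_zero_iff, map_eq_zero_iff _
    ContinuousLinearMap.adjoint.injective] at hDD
  exact sub_eq_zero.1 hDD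

theorem IsWeylSingular.not_finiteDimensional_ker_of_comp_adjoint {T : H →L[ℂ] X}
    (hT : IsWeylSingular T) (hK : IsCompactOperator (T ∘L T.adjoint - 1 : X →L[ℂ] X)) :
    ¬ FiniteDimensional ℂ (LinearMap.ker T.toLinearMap) := by
  have hG : IsSelfAdjoint (T ∘L T.adjoint) := by
    rw [ContinuousLinearMap.isSelfAdjoint_iff', ContinuousLinearMap.adjoint_comp,
      ContinuousLinearMap.adjoint_adjoint]
  have hacc : ¬ AccPt (0 : ℂ) (𝓟 (spectrum ℂ (T ∘L T.adjoint))) := fun hacc => by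
    have hone := (isWeylSingular_of_accPt hG hacc).add_isCompactOperator
      (K := -(T ∘L T.adjoint - 1)) hK.neg
    rw [← sub_eq_add_neg, sub_sub_cancel] at hone
    exact not_isWeylSingular_one hone
  obtain ⟨R, hR⟩ := exists_comp_comp_eq_self_of_not_accPt hG hacc
  exact hT.not_finiteDimensional_ker (comp_comp_eq_self_of_comp_adjoint hR)

end GramOperator

section OrthogonalProjections

theorem isCompactOperator_sum {𝕜 ι E F : Type*} [NormedField 𝕜] [NormedAddCommGroup E]
    [NormedSpace 𝕜 E] [NormedAddCommGroup F] [NormedSpace 𝕜 F] {K : ι → E →L[𝕜] F}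
    {s : Finset ι} (hK : ∀ i ∈ s, IsCompactOperator (K i)) :
    IsCompactOperator (∑ i ∈ s, K i : E →L[𝕜] F) :=
  (compactOperator (RingHom.id 𝕜) E F).sum_mem hK

theorem isCompactOperator_of_forall_proj_comp {𝕜 ι E : Type*} [NormedField 𝕜] [Finite ι]
    [NormedAddCommGroup E] [NormedSpace 𝕜 E] {p : ENNReal} [Fact (1 ≤ p)] {G : ι → Type*}
    [∀ i, NormedAddCommGroup (G i)] [∀ i, NormedSpace 𝕜 (G i)] {K : E →L[𝕜] PiLp p G}
    (hK : ∀ i, IsCompactOperator (PiLp.proj p G i ∘L K : E →L[𝕜] G i)) :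
    IsCompactOperator K := by
  classical
  cases nonempty_fintype ι
  let S (i : ι) : G i →L[𝕜] PiLp p G :=
    ((PiLp.continuousLinearEquiv p 𝕜 G).symm : (∀ i, G i) →L[𝕜] PiLp p G) ∘L
      ContinuousLinearMap.single 𝕜 G i
  have hsum : ∑ i, S i ∘L PiLp.proj p G i ∘L K = K := by
    ext x i
    simp [S, Finset.sum_pi_single]
  have hcomp (i) : IsCompactOperator (S i ∘L PiLp.proj p G i ∘L K) := (hK i).clm_comp (S i)
  rw [← hsum]
  exact isCompactOperator_sum fun i _ => hcomp i

variable {𝕜 ι H : Type*} [RCLike 𝕜] [NormedAddCommGroup H] [InnerProductSpace 𝕜 H]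

theorem starProjection_orthogonal_range_of_isStarProjection [CompleteSpace H]
    {P : H →L[𝕜] H} (hP : IsStarProjection P) :
    (LinearMap.range P.toLinearMap)ᗮ.starProjection = 1 - P := by
  obtain ⟨_, hPU⟩ := isStarProjection_iff_eq_starProjection_range.1 hP
  rw [Submodule.starProjection_orthogonal', ← hPU]

theorem orthogonal_orthogonal_range_of_isStarProjection [CompleteSpace H]
    {P : H →L[𝕜] H} (hP : IsStarProjection P) :
    (LinearMap.range P.toLinearMap)ᗮᗮ = LinearMap.range P.toLinearMap := by
  obtain ⟨_, -⟩ := isStarProjection_iff_eq_starProjection_range.1 hP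
  exact Submodule.orthogonal_orthogonal _

theorem orthogonalProjectionOnto_comp_starProjection (U : Submodule 𝕜 H)
    [U.HasOrthogonalProjection] :
    U.orthogonalProjectionOnto ∘L U.starProjection = U.orthogonalProjectionOnto :=
  ContinuousLinearMap.ext fun _ => Submodule.orthogonalProjectionOnto_mem_subspace_eq_self _

theorem isCompactOperator_orthogonalProjectionOnto_comp_subtypeL {U V : Submodule 𝕜 H}
    [U.HasOrthogonalProjection] [V.HasOrthogonalProjection]
    (h : IsCompactOperator (U.starProjection ∘L V.starProjection)) :
    IsCompactOperator (U.orthogonalProjectionOnto ∘L V.subtypeL) := by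
  have hV : V.starProjection ∘L V.subtypeL = V.subtypeL :=
    ContinuousLinearMap.ext fun y => Submodule.starProjection_eq_self_iff.2 y.2
  have hfactor : U.orthogonalProjectionOnto ∘L V.subtypeL =
      U.orthogonalProjectionOnto ∘L (U.starProjection ∘L V.starProjection) ∘L V.subtypeL := by
    rw [ContinuousLinearMap.comp_assoc, hV, ← ContinuousLinearMap.comp_assoc,
      orthogonalProjectionOnto_comp_starProjection]
  rw [hfactor]
  exact (h.comp_clm V.subtypeL).clm_comp U.orthogonalProjectionOnto

/-- The operator `x ↦ (Pᵢ x)ᵢ` from `H` to the Hilbert sum of finitely many subspaces `Uᵢ`, where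
`Pᵢ` is the orthogonal projection onto `Uᵢ`. Its adjoint is the sum map `(yᵢ)ᵢ ↦ ∑ᵢ yᵢ`. -/
noncomputable def orthogonalProjections (U : ι → Submodule 𝕜 H)
    [∀ i, (U i).HasOrthogonalProjection] :
    H →L[𝕜] PiLp 2 fun i => U i :=
  ((PiLp.continuousLinearEquiv 2 𝕜 fun i => U i).symm : (∀ i, U i) →L[𝕜] PiLp 2 fun i => U i) ∘L
    ContinuousLinearMap.pi fun i => (U i).orthogonalProjectionOnto

theorem ker_orthogonalProjections (U : ι → Submodule 𝕜 H) [∀ i, (U i).HasOrthogonalProjection] :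
    LinearMap.ker (orthogonalProjections U).toLinearMap = ⨅ i, (U i)ᗮ := by
  ext x
  rw [LinearMap.mem_ker, Submodule.mem_iInf]
  refine (PiLp.ext_iff ..).trans (forall_congr' fun i => ?_)
  exact Submodule.orthogonalProjectionOnto_eq_zero_iff

theorem adjoint_orthogonalProjections [Fintype ι] [CompleteSpace H] (U : ι → Submodule 𝕜 H)
    [∀ i, CompleteSpace (U i)] :
    (orthogonalProjections U).adjoint = ∑ i, (U i).subtypeL ∘L PiLp.proj 2 (fun i => U i) i := by
  symm
  rw [ContinuousLinearMap.eq_adjoint_iff]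
  intro y x
  simp [orthogonalProjections, PiLp.inner_apply, sum_inner]

theorem isCompactOperator_orthogonalProjections_comp_adjoint_sub_one [Fintype ι] [CompleteSpace H]
    {U : ι → Submodule 𝕜 H} [∀ i, CompleteSpace (U i)]
    (hU : Pairwise fun i j =>
      IsCompactOperator ((U i).starProjection ∘L (U j).starProjection)) :
    IsCompactOperator (orthogonalProjections U ∘L (orthogonalProjections U).adjoint - 1 :
      (PiLp 2 fun i => U i) →L[𝕜] PiLp 2 fun i => U i) := by
  classical
  refine isCompactOperator_of_forall_proj_comp fun i => ?_
  have hentry : PiLp.proj 2 (fun i => U i) i ∘L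
        (orthogonalProjections U ∘L (orthogonalProjections U).adjoint - 1) =
      ∑ j ∈ Finset.univ.erase i, ((U i).orthogonalProjectionOnto ∘L (U j).subtypeL) ∘L
        PiLp.proj 2 (fun i => U i) j :=
    ContinuousLinearMap.ext fun y => by
      rw [adjoint_orthogonalProjections]
      change (U i).orthogonalProjectionOnto ((∑ j, (U j).subtypeL ∘L PiLp.proj 2 _ j) y) - y i = _
      rw [← Finset.add_sum_erase _ _ (Finset.mem_univ i)]
      simp [sum_apply]
  rw [hentry]
  refine isCompactOperator_sum fun j hj => ?_
  exact (isCompactOperator_orthogonalProjectionOnto_comp_subtypeL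
    (hU (Finset.ne_of_mem_erase hj).symm)).comp_clm (PiLp.proj 2 (fun i => U i) j)

end OrthogonalProjections

section Sum

variable {H : Type*} [NormedAddCommGroup H] [InnerProductSpace ℂ H] [CompleteSpace H]

theorem IsWeylSingular.not_finiteDimensional_iInf_orthogonal {ι F : Type*} [Finite ι]
    [NormedAddCommGroup F] [NormedSpace ℂ F] {U : ι → Submodule ℂ H} [∀ i, CompleteSpace (U i)]
    (hU : Pairwise fun i j => IsCompactOperator ((U i).starProjection ∘L (U j).starProjection))
    {T : H →L[ℂ] F} (hT : IsWeylSingular T) {W : ι → F →L[ℂ] H}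
    (hW : ∀ i, IsCompactOperator ((U i).starProjection - W i ∘L T)) :
    ¬ FiniteDimensional ℂ (⨅ i, (U i)ᗮ : Submodule ℂ H) := by
  cases nonempty_fintype ι
  let L : F →L[ℂ] PiLp 2 fun i => U i :=
    ((PiLp.continuousLinearEquiv 2 ℂ fun i => U i).symm : (∀ i, U i) →L[ℂ] PiLp 2 fun i => U i) ∘L
      ContinuousLinearMap.pi fun i => (U i).orthogonalProjectionOnto ∘L W i
  have hK : IsCompactOperator (orthogonalProjections U - L ∘L T) := by
    refine isCompactOperator_of_forall_proj_comp fun i => ?_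
    have hcomponent : PiLp.proj 2 (fun i => U i) i ∘L (orthogonalProjections U - L ∘L T) =
        (U i).orthogonalProjectionOnto ∘L ((U i).starProjection - W i ∘L T) := by
      rw [ContinuousLinearMap.comp_sub (U i).orthogonalProjectionOnto,
        orthogonalProjectionOnto_comp_starProjection]
      rfl
    rw [hcomponent]
    exact (hW i).clm_comp (U i).orthogonalProjectionOnto
  have hsing : IsWeylSingular (orthogonalProjections U) := by
    simpa only [add_sub_cancel] using (hT.clm_comp L).add_isCompactOperator hK
  rw [← ker_orthogonalProjections]
  exact hsing.not_finiteDimensional_ker_of_comp_adjoint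
    (isCompactOperator_orthogonalProjections_comp_adjoint_sub_one hU)

variable {N : ℕ} {A : Fin N → H →L[ℂ] H} (hA : ∀ i, IsSelfAdjoint (A i))

theorem not_finiteDimensional_commonSpectralSubspace
    (hcomp : Pairwise fun i j => IsCompactOperator (A i ∘L A j))
    (hsing : IsWeylSingular (∑ i, A i)) {ε : ℝ} (hε : 0 < ε) :
    ¬ FiniteDimensional ℂ (commonSpectralSubspace A hA ε) := by
  choose W V hW hV using fun i => exists_comp_eq_one_sub_proj_Icc (hA i) hε
  have hE (i) : IsStarProjection ((spectralMeasure (A i) (hA i)).proj (Icc (-ε) ε)) :=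
    (spectralMeasure (A i) (hA i)).isStarProjection _ measurableSet_Icc
  let U (i : Fin N) : Submodule ℂ H :=
    (LinearMap.range ((spectralMeasure (A i) (hA i)).proj (Icc (-ε) ε)).toLinearMap)ᗮ
  have hproj (i) : (U i).starProjection = W i ∘L A i :=
    (starProjection_orthogonal_range_of_isStarProjection (hE i)).trans (hW i).symm
  have hUU : Pairwise fun i j =>
      IsCompactOperator ((U i).starProjection ∘L (U j).starProjection) := fun i j hij => by
    have hadj : (U j).starProjection = A j ∘L (W j).adjoint := by
      rw [← (isSelfAdjoint_starProjection (U j)).adjoint_eq, hproj,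
        ContinuousLinearMap.adjoint_comp, (hA j).adjoint_eq]
    simp only [hproj i, hadj]
    exact ((hcomp hij).comp_clm (W j).adjoint).clm_comp (W i)
  have hWA (i) : IsCompactOperator ((U i).starProjection - W i ∘L ∑ j, A j) := by
    have hsum : (U i).starProjection - W i ∘L ∑ j, A j =
        -∑ j ∈ Finset.univ.erase i, V i ∘L A i ∘L A j := by
      rw [hproj, ← Finset.add_sum_erase _ _ (Finset.mem_univ i), ContinuousLinearMap.comp_add,
        sub_add_cancel_left, ContinuousLinearMap.comp_finsetSum]
      simp only [← hV, ContinuousLinearMap.comp_assoc]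
    rw [hsum]
    refine (isCompactOperator_sum fun j hj => ?_).neg
    exact (hcomp (Finset.ne_of_mem_erase hj).symm).clm_comp (V i)
  have hclosed : commonSpectralSubspace A hA ε = ⨅ i, (U i)ᗮ :=
    iInf_congr fun i => (orthogonal_orthogonal_range_of_isStarProjection (hE i)).symm
  rw [hclosed]
  exact hsing.not_finiteDimensional_iInf_orthogonal hUU hWA

theorem norm_sum_apply_le_of_mem_commonSpectralSubspace {ε : ℝ} (hε : 0 ≤ ε) {x : H}
    (hx : x ∈ commonSpectralSubspace A hA ε) : ‖(∑ i, A i) x‖ ≤ N * ε * ‖x‖ := by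
  rw [commonSpectralSubspace, Submodule.mem_iInf] at hx
  calc ‖(∑ i, A i) x‖ ≤ ∑ i, ‖A i x‖ := by
        rw [sum_apply]
        exact norm_sum_le _ _
    _ ≤ ∑ _ : Fin N, ε * ‖x‖ :=
        Finset.sum_le_sum fun i _ => norm_apply_le_of_mem_range_proj_Icc (hA i) hε (hx i)
    _ = N * ε * ‖x‖ := by simp [mul_assoc]

theorem isWeylSingular_sum_of_not_finiteDimensional_commonSpectralSubspace
    (h : ∀ ε : ℝ, 0 < ε → ¬ FiniteDimensional ℂ (commonSpectralSubspace A hA ε)) :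
    IsWeylSingular (∑ i, A i) := by
  refine isWeylSingular_of_forall_exists_submodule fun δ hδ => ?_
  have hε : 0 < δ / (N + 1) := by positivity
  refine ⟨_, h _ hε, fun x hx => ?_⟩
  calc ‖(∑ i, A i) x‖ ≤ N * (δ / (N + 1)) * ‖x‖ :=
        norm_sum_apply_le_of_mem_commonSpectralSubspace hA hε.le hx
    _ ≤ δ * ‖x‖ := by
        gcongr
        rw [mul_div_assoc', div_le_iff₀ (by positivity)]
        linarith

end Sum

end SpectralSum

theorem mainTheorem1 {H : Type*} [NormedAddCommGroup H] [InnerProductSpace ℂ H] [CompleteSpace H]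
    {N : ℕ} (A : Fin N → H →L[ℂ] H) (hA : ∀ i, IsSelfAdjoint (A i))
    (hcomp : ∀ i j, i ≠ j → IsCompactOperator (A i ∘L A j)) :
    (0 : ℂ) ∈ SpectralSum.essentialSpectrum (∑ i, A i) ↔
      ∀ ε : ℝ, 0 < ε →
        ¬ FiniteDimensional ℂ (SpectralSum.commonSpectralSubspace A hA ε) := by
  have hsum : IsSelfAdjoint (∑ i, A i) := isSelfAdjoint_sum _ fun i _ => hA i
  rw [SpectralSum.zero_mem_essentialSpectrum_iff_isWeylSingular hsum]
  constructor
  · intro hsing ε hε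
    exact SpectralSum.not_finiteDimensional_commonSpectralSubspace hA @hcomp hsing hε
  · exact SpectralSum.isWeylSingular_sum_of_not_finiteDimensional_commonSpectralSubspace hA
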